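/- Let $p$ be a prime. All groups are finite. A group is $p$-solvable if each of its chief factors is a $p$-group or has order prime to $p$; it is $p$-supersolvable if each of its chief factors has order $p$ or order prime to $p$. For a group $T$, let $T^{\mathscr U_p}$ denote its $p$-supersolvable residual, that is, the intersection of all normal subgroups $N$ of $T$ such that $T/N$ is $p$-supersolvable. For a subgroup $H$ of a group $G$, the weak norm of $H$ in $G$ with respect to $\mathscr U_p$ is $$N_{\mathscr U_p}(G,H)=\bigcap_{T\le H} N_G\bigl(T^{\mathscr U_p}\bigr),$$ where $T$ runs over all subgroups of $H$. **Theorem.** Let $G$ be a finite $p$-solvable group and let $H$ be a normal subgroup of $G$. Then $N_{\mathscr U_p}(G,H)=1$ if and only if $C_G\bigl(H^{\mathscr U_p}\bigr)=1$. -/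

import Mathlib

universe u

namespace WeakNorm

/-- `H / K` is a chief factor of `G`: `K < H` are normal subgroups of `G` and no normal subgroup
of `G` lies strictly between them. The order of `H / K` is `K.relIndex H`. -/
structure IsChiefFactor {G : Type u} [Group G] (K H : Subgroup G) : Prop where
  normal_bot : K.Normal
  normal_top : H.Normal
  lt : K < H
  eq_or_eq : ∀ M : Subgroup G, M.Normal → K ≤ M → M ≤ H → M = K ∨ M = H

/-- A finite group is `p`-solvable if every chief factor is a `p`-group or a `p'`-group. -/
structure IsPSolvable (p : ℕ) (G : Type u) [Group G] : Prop where
  finite : Finite G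
  chief : ∀ K H : Subgroup G, IsChiefFactor K H →
    (∃ n : ℕ, K.relIndex H = p ^ n) ∨ ¬ p ∣ K.relIndex H

/-- A finite group is `p`-supersolvable if every chief factor is of order `p` or a `p'`-group. -/
structure IsPSupersolvable (p : ℕ) (G : Type u) [Group G] : Prop where
  finite : Finite G
  chief : ∀ K H : Subgroup G, IsChiefFactor K H →
    K.relIndex H = p ∨ ¬ p ∣ K.relIndex H

/-- The residual `G^F` of `G` with respect to a class `F` of groups: the intersection of all
normal subgroups `N` of `G` such that `G / N` belongs to `F`. -/
def residual (F : ∀ (X : Type u) [Group X], Prop) (G : Type u) [Group G] : Subgroup G :=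
  sInf {N : Subgroup G | ∃ _ : N.Normal, F (G ⧸ N)}

/-- The residual `T^F` of a subgroup `T` of `G`, viewed as a subgroup of `G`. -/
def subgroupResidual (F : ∀ (X : Type u) [Group X], Prop) {G : Type u} [Group G]
    (T : Subgroup G) : Subgroup G :=
  (residual F T).map T.subtype

/-- The weak norm `N_F(G, H)` of `H` in `G` with respect to `F`: the intersection of the
normalizers in `G` of the `F`-residuals of all subgroups `T` of `H`. -/
def weakNorm (F : ∀ (X : Type u) [Group X], Prop) {G : Type u} [Group G]
    (H : Subgroup G) : Subgroup G :=
  ⨅ (T : Subgroup G) (_ : T ≤ H), Subgroup.normalizer (subgroupResidual F T : Set G)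

end WeakNorm

/-! Residuals grow with the subgroup, so C_G(H^U) normalizes every T^U with T ≤ H and lies in the
weak norm. Conversely, the weak norm is normal; if nontrivial it contains a minimal normal subgroup
L of G, and it suffices that R = H^U centralizes L. By `p`-solvability L is a `p'`-group or a
`p`-group. Put C = C_H(L).

If L is a `p'`-group (`pRes_le_centralizer_of_not_dvd`), take D/C a maximal normal `p'`-section of
H/C. If R is not in D, there is a `p`-chief factor F/D below RD. With P Sylow in F and T = N_H(P),
Frattini gives TD = H, and commutators of L with `p`-elements of T^U ∩ F vanish, forcing F ≤ D.

If L is a `p`-group (`pRes_le_centralizer_of_isPGroup`), a minimal supplement T of C in H satisfies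
L ∩ T = 1. Then [L, T^U] ≤ L ∩ T = 1, so T^U ≤ C and hence R ≤ C. -/

namespace WeakNorm

open Subgroup

/-! ### Divisibility of indices of normal sections. -/

section Index

variable {X Y : Type*} [Group X] [Group Y]

theorem relIndex_dvd_relIndex_of_le_right {K L M : Subgroup X} (hK : K.Normal) (h : L ≤ M) :
    K.relIndex L ∣ K.relIndex M := by
  rw [← relIndex_subgroupOf h]
  exact relIndex_dvd_index_of_normal _ _

theorem relIndex_comap_dvd {K M : Subgroup Y} (hK : K.Normal) (f : X →* Y) :
    (K.comap f).relIndex (M.comap f) ∣ K.relIndex M := by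
  rw [relIndex_comap]
  exact relIndex_dvd_relIndex_of_le_right hK (map_comap_le f M)

theorem relIndex_sup_dvd {K M N : Subgroup X} (hK : K.Normal) (hN : N.Normal) (h : K ≤ M) :
    (K ⊔ N).relIndex (M ⊔ N) ∣ K.relIndex M := by
  have : M ⊔ N = M ⊔ (K ⊔ N) := by rw [← sup_assoc, sup_eq_left.2 h]
  rw [this, relIndex_sup_right]
  exact relIndex_dvd_of_le_left _ le_sup_left

theorem relIndex_map_dvd {K M : Subgroup X} (hK : K.Normal) (h : K ≤ M) (f : X →* Y) :
    (K.map f).relIndex (M.map f) ∣ K.relIndex M := by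
  rw [relIndex_map_map]
  exact relIndex_sup_dvd hK inferInstance h

theorem relIndex_inf_dvd {K M N : Subgroup X} (hK : K.Normal) :
    (K ⊓ N).relIndex (M ⊓ N) ∣ K.relIndex M := by
  have h : (K ⊓ N).relIndex (M ⊓ N) = K.relIndex (M ⊓ N) := by
    rw [← inf_relIndex_right, ← inf_relIndex_right K]
    congr 1
    ext x
    simp only [mem_inf]
    tauto
  rw [h]
  exact relIndex_dvd_relIndex_of_le_right hK inf_le_left

theorem eq_or_not_dvd_of_dvd {p d n : ℕ} (hp : p.Prime) (hd : d ∣ n) (hn : n = p ∨ ¬ p ∣ n) :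
    d = p ∨ ¬ p ∣ d := by
  rcases hn with rfl | hn
  · rcases (Nat.dvd_prime hp).1 hd with rfl | rfl
    · exact Or.inr hp.not_dvd_one
    · exact Or.inl rfl
  · exact Or.inr fun h => hn (h.trans hd)

end Index

/-- One step of a normal series whose factors have order `p` or prime to `p`. -/
structure PStep (p : ℕ) {X : Type*} [Group X] (K M : Subgroup X) : Prop where
  normal_bot : K.Normal
  normal_top : M.Normal
  le : K ≤ M
  index : K.relIndex M = p ∨ ¬ p ∣ K.relIndex M

/-- There is a normal series from `K` to `M` with all factors of order `p` or prime to `p`. -/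
abbrev PSeries (p : ℕ) {X : Type*} [Group X] (K M : Subgroup X) : Prop :=
  Relation.ReflTransGen (PStep p) K M

/-! ### Stability of normal series with factors of order `p` or prime to `p`. -/

section Series

variable {p : ℕ} {X Y : Type*} [Group X] [Group Y]

theorem PSeries.comap (hp : p.Prime) {K M : Subgroup Y} (h : PSeries p K M) (f : X →* Y) :
    PSeries p (K.comap f) (M.comap f) := by
  refine h.lift (Subgroup.comap f) fun A B hAB => ?_
  have := hAB.normal_bot
  have := hAB.normal_top
  exact ⟨inferInstance, inferInstance, comap_mono hAB.le,
    eq_or_not_dvd_of_dvd hp (relIndex_comap_dvd hAB.normal_bot f) hAB.index⟩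

theorem PSeries.map (hp : p.Prime) {K M : Subgroup X} (h : PSeries p K M) {f : X →* Y}
    (hf : Function.Surjective f) : PSeries p (K.map f) (M.map f) := by
  refine h.lift (Subgroup.map f) fun A B hAB => ?_
  exact ⟨hAB.normal_bot.map f hf, hAB.normal_top.map f hf, map_mono hAB.le,
    eq_or_not_dvd_of_dvd hp (relIndex_map_dvd hAB.normal_bot hAB.le f) hAB.index⟩

theorem PSeries.sup (hp : p.Prime) {K M N : Subgroup X} (h : PSeries p K M) (hN : N.Normal) :
    PSeries p (K ⊔ N) (M ⊔ N) := by
  refine h.lift (· ⊔ N) fun A B hAB => ?_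
  have := hAB.normal_bot
  have := hAB.normal_top
  exact ⟨inferInstance, inferInstance, sup_le_sup_right hAB.le N,
    eq_or_not_dvd_of_dvd hp (relIndex_sup_dvd hAB.normal_bot hN hAB.le) hAB.index⟩

theorem PSeries.inf (hp : p.Prime) {K M N : Subgroup X} (h : PSeries p K M) (hN : N.Normal) :
    PSeries p (K ⊓ N) (M ⊓ N) := by
  refine h.lift (· ⊓ N) fun A B hAB => ?_
  have := hAB.normal_bot
  have := hAB.normal_top
  exact ⟨inferInstance, inferInstance, inf_le_inf_right N hAB.le,
    eq_or_not_dvd_of_dvd hp (relIndex_inf_dvd hAB.normal_bot) hAB.index⟩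

theorem PSeries.mono (hp : p.Prime) {K N : Subgroup X} (h : PSeries p K ⊤) (hN : N.Normal)
    (hKN : K ≤ N) : PSeries p N ⊤ := by
  simpa [hKN] using h.sup hp hN

theorem PSeries.inf_top (hp : p.Prime) {K N : Subgroup X} (hK : PSeries p K ⊤)
    (hN : PSeries p N ⊤) (hnN : N.Normal) : PSeries p (K ⊓ N) ⊤ := by
  have h := hK.inf hp hnN
  rw [top_inf_eq] at h
  exact Relation.ReflTransGen.trans h hN

/-- At the first step A ≤ B of the series where M ∩ B leaves K, chiefness gives K(M ∩ B) = M, so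
|M/K| divides |B/A|. -/
theorem PSeries.of_isChiefFactor (hp : p.Prime) {N K M : Subgroup X} (h : PSeries p N ⊤)
    (hc : IsChiefFactor K M) (hN : M ⊓ N ≤ K) : K.relIndex M = p ∨ ¬ p ∣ K.relIndex M := by
  revert hN
  refine Relation.ReflTransGen.head_induction_on h ?_ ?_
  · intro hN
    rw [inf_top_eq] at hN
    exact absurd hN hc.lt.not_ge
  · intro A B hAB _ ih hA
    by_cases hB : M ⊓ B ≤ K
    · exact ih hB
    have := hAB.normal_bot
    have := hAB.normal_top
    have := hc.normal_bot
    have := hc.normal_top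
    have hM : K ⊔ M ⊓ B = M := by
      refine (hc.eq_or_eq (K ⊔ M ⊓ B) inferInstance le_sup_left
        (sup_le hc.lt.le inf_le_left)).resolve_left fun h => hB ?_
      rw [← h]
      exact le_sup_right
    refine eq_or_not_dvd_of_dvd hp ?_ hAB.index
    have h1 : K.relIndex M = K.relIndex (M ⊓ B) := by
      conv_lhs => rw [← hM, relIndex_sup_left]
    have h2 : K.relIndex (M ⊓ B) ∣ (M ⊓ A).relIndex (M ⊓ B) := relIndex_dvd_of_le_left _ hA
    rw [h1]
    refine h2.trans ?_
    rw [inf_comm M A, inf_comm M B]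
    exact relIndex_inf_dvd hAB.normal_bot

end Series

theorem exists_isChiefFactor {X : Type*} [Group X] [Finite X] {K H : Subgroup X} (hK : K.Normal)
    (hH : H.Normal) (hKH : K < H) : ∃ M, IsChiefFactor K M ∧ M ≤ H := by
  obtain ⟨M, ⟨hM, hKM, hMH⟩, hmin⟩ :=
    (Set.toFinite {M : Subgroup X | M.Normal ∧ K < M ∧ M ≤ H}).exists_minimal ⟨H, hH, hKH, le_rfl⟩
  refine ⟨M, ⟨hK, hM, hKM, fun A hA hKA hAM => ?_⟩, hMH⟩
  rcases hKA.eq_or_lt with h | h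
  · exact Or.inl h.symm
  · exact Or.inr (le_antisymm hAM (hmin ⟨hA, h, hAM.trans hMH⟩ hAM))

/-! ### The `p`-supersolvable residual. -/

section Residual

variable {p : ℕ}

theorem isPSupersolvable_iff (hp : p.Prime) {X : Type u} [Group X] [Finite X] :
    IsPSupersolvable p X ↔ PSeries p (⊥ : Subgroup X) ⊤ := by
  constructor
  · intro h
    have key : ∀ K : Subgroup X, K.Normal → PSeries p K ⊤ := by
      intro K
      induction K using WellFoundedGT.induction with
      | ind K ih =>
        intro hK
        rcases eq_or_ne K ⊤ with rfl | hne
        · exact Relation.ReflTransGen.refl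
        · obtain ⟨M, hM, -⟩ := exists_isChiefFactor hK inferInstance hne.lt_top
          exact Relation.ReflTransGen.head ⟨hK, hM.normal_top, hM.lt.le, h.chief K M hM⟩
            (ih M hM.lt hM.normal_top)
    exact key ⊥ inferInstance
  · exact fun h => ⟨inferInstance, fun K M hKM => h.of_isChiefFactor hp hKM (by simp)⟩

theorem isPSupersolvable_quotient_iff (hp : p.Prime) {X : Type u} [Group X] [Finite X]
    (N : Subgroup X) [N.Normal] : IsPSupersolvable p (X ⧸ N) ↔ PSeries p N ⊤ := by
  rw [isPSupersolvable_iff hp]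
  constructor
  · intro h
    simpa using h.comap hp (QuotientGroup.mk' N)
  · intro h
    have := h.map hp (QuotientGroup.mk'_surjective N)
    rwa [QuotientGroup.map_mk'_self, map_top_of_surjective _ (QuotientGroup.mk'_surjective N)]
      at this

/-- The `p`-supersolvable residual of a group. -/
abbrev pResidual (p : ℕ) (X : Type u) [Group X] : Subgroup X :=
  residual (fun (Y : Type u) [Group Y] => IsPSupersolvable p Y) X

/-- The `p`-supersolvable residual of a subgroup. -/
abbrev pRes (p : ℕ) {G : Type u} [Group G] (T : Subgroup G) : Subgroup G :=
  (pResidual p T).map T.subtype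

theorem pResidual_le (hp : p.Prime) {X : Type u} [Group X] [Finite X] {N : Subgroup X}
    (hN : N.Normal) (h : PSeries p N ⊤) : pResidual p X ≤ N :=
  sInf_le ⟨hN, (isPSupersolvable_quotient_iff hp N).2 h⟩

/-- Admissible normal subgroups are closed under intersection, so a minimal one is the residual. -/
theorem pResidual_spec (hp : p.Prime) {X : Type u} [Group X] [Finite X] :
    (pResidual p X).Normal ∧ PSeries p (pResidual p X) ⊤ := by
  obtain ⟨N, ⟨hN, hs⟩, hmin⟩ :=
    (Set.toFinite {N : Subgroup X | N.Normal ∧ PSeries p N ⊤}).exists_minimal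
      ⟨⊤, inferInstance, Relation.ReflTransGen.refl⟩
  have h : pResidual p X = N := by
    refine le_antisymm (pResidual_le hp hN hs) (le_sInf ?_)
    rintro M ⟨hM, hMs⟩
    have hMs' : PSeries p M ⊤ := (isPSupersolvable_quotient_iff hp M).1 hMs
    exact (hmin ⟨inferInstance, hMs'.inf_top hp hs hN⟩ inf_le_right).trans inf_le_left
  rw [h]
  exact ⟨hN, hs⟩

theorem pResidual_map (hp : p.Prime) {X Y : Type u} [Group X] [Group Y] [Finite X] [Finite Y]
    {f : X →* Y} (hf : Function.Surjective f) : (pResidual p X).map f = pResidual p Y := by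
  obtain ⟨hX, hXs⟩ := pResidual_spec hp (X := X)
  obtain ⟨hY, hYs⟩ := pResidual_spec hp (X := Y)
  apply le_antisymm
  · rw [map_le_iff_le_comap]
    refine pResidual_le hp inferInstance ?_
    simpa using hYs.comap hp f
  · refine pResidual_le hp (hX.map f hf) ?_
    have := hXs.map hp hf
    rwa [map_top_of_surjective f hf] at this

variable {G : Type u} [Group G]

theorem pRes_le (T : Subgroup G) : pRes p T ≤ T := map_subtype_le _

variable [Finite G]

theorem pRes_mono (hp : p.Prime) {T H : Subgroup G} (h : T ≤ H) : pRes p T ≤ pRes p H := by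
  have hH := pResidual_spec hp (X := H)
  have := hH.1
  have h1 : pResidual p T ≤ (pResidual p H).comap (inclusion h) := by
    refine pResidual_le hp inferInstance ?_
    simpa using hH.2.comap hp (inclusion h)
  rintro _ ⟨x, hx, rfl⟩
  exact ⟨inclusion h x, h1 hx, rfl⟩

theorem pRes_map (hp : p.Prime) {G' : Type u} [Group G'] [Finite G'] (T : Subgroup G)
    (f : G →* G') : (pRes p T).map f = pRes p (T.map f) := by
  have := pResidual_map hp (f := f.subgroupMap T) (f.subgroupMap_surjective T)
  rw [pRes, pRes, ← this, map_map, map_map]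
  rfl

theorem pRes_conj_mem (hp : p.Prime) {T : Subgroup G} {g : G}
    (hg : T.map (MulAut.conj g).toMonoidHom = T) {x : G} (hx : x ∈ pRes p T) :
    g * x * g⁻¹ ∈ pRes p T := by
  have h := pRes_map hp T (MulAut.conj g).toMonoidHom
  rw [hg] at h
  rw [← h]
  exact ⟨x, hx, by simp⟩

theorem map_conj_eq_of_normal {T : Subgroup G} (hT : T.Normal) (g : G) :
    T.map (MulAut.conj g).toMonoidHom = T := by
  refine Subgroup.eq_of_le_of_card_ge ?_ ?_
  · rintro _ ⟨x, hx, rfl⟩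
    exact hT.conj_mem x hx g
  · exact (card_map_of_injective (MulAut.conj g).injective).ge

theorem pRes_normal (hp : p.Prime) {H : Subgroup G} (hH : H.Normal) : (pRes p H).Normal :=
  ⟨fun _ hx g => pRes_conj_mem hp (map_conj_eq_of_normal hH g) hx⟩

theorem pRes_sup_eq (hp : p.Prime) {T H C : Subgroup G} (hC : C.Normal) (hT : T ⊔ C = H ⊔ C) :
    pRes p T ⊔ C = pRes p H ⊔ C := by
  have h : T.map (QuotientGroup.mk' C) = H.map (QuotientGroup.mk' C) := by
    rw [map_eq_map_iff, QuotientGroup.ker_mk', hT]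
  have h2 : (pRes p T).map (QuotientGroup.mk' C) = (pRes p H).map (QuotientGroup.mk' C) := by
    rw [pRes_map hp, pRes_map hp, h]
  rwa [map_eq_map_iff, QuotientGroup.ker_mk'] at h2

/-- A `p'`-factor D/C added below a series from D to H leaves it admissible. -/
theorem pRes_le_of_not_dvd (hp : p.Prime) {H C D : Subgroup G} (hC : C.Normal) (hD : D.Normal)
    (hCD : C ≤ D) (hDH : D ≤ H) (hi : ¬ p ∣ C.relIndex D) (h : pRes p H ≤ D) :
    pRes p H ≤ C := by
  have hH := pResidual_spec hp (X := H)
  have h1 : pResidual p H ≤ D.subgroupOf H := fun x hx => h ⟨x, hx, rfl⟩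
  have h2 : PSeries p (D.subgroupOf H) ⊤ := hH.2.mono hp inferInstance h1
  have hi' : ¬ p ∣ (C.subgroupOf H).relIndex (D.subgroupOf H) := by
    rwa [relIndex_subgroupOf hDH]
  have h3 : PSeries p (C.subgroupOf H) ⊤ := Relation.ReflTransGen.head
    ⟨inferInstance, inferInstance, comap_mono hCD, Or.inr hi'⟩ h2
  rintro _ ⟨x, hx, rfl⟩
  exact pResidual_le hp inferInstance h3 hx

end Residual

/-! ### Normal complements by Schur–Zassenhaus and Frattini arguments. -/

section Complement

/-- Complements are the stabilizers of points of `V.QuotientDiff`, on which V acts transitively. -/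
theorem exists_conj_of_isComplement' {E : Type*} [Group E] [Finite E] {V : Subgroup E} [V.Normal]
    [IsMulCommutative V] (hV : (Nat.card V).Coprime V.index) {A A' : Subgroup E}
    (hA : IsComplement' V A) (hA' : IsComplement' V A') :
    ∃ v ∈ V, ∀ a ∈ A, v * a * v⁻¹ ∈ A' := by
  have key : ∀ {S : Subgroup E} (hS : IsComplement' V S), ∃ α : V.QuotientDiff,
      MulAction.stabilizer E α = S := by
    intro S hS
    let s : V.LeftTransversal := ⟨S, hS.symm⟩
    let α : V.QuotientDiff := Quotient.mk'' s
    have hle : S ≤ MulAction.stabilizer E α := by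
      intro g hg
      have h : MulOpposite.op g⁻¹ • s = s :=
        Subtype.ext (op_smul_coe_set (S.inv_mem hg))
      exact congrArg Quotient.mk'' h
    refine ⟨α, (Subgroup.eq_of_le_of_card_ge hle ?_).symm⟩
    have h1 := hS.card_mul_card
    have h2 := (isComplement'_stabilizer_of_coprime (α := α) hV).card_mul_card
    exact (Nat.eq_of_mul_eq_mul_left Nat.card_pos (h2.trans h1.symm)).le
  obtain ⟨α, hα⟩ := key hA
  obtain ⟨β, hβ⟩ := key hA'
  obtain ⟨v, hv⟩ := exists_smul_eq hV α β
  have hv' : (v : E) • α = β := hv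
  refine ⟨v, v.2, fun a ha => ?_⟩
  rw [← hα, MulAction.mem_stabilizer_iff] at ha
  rw [← hβ, MulAction.mem_stabilizer_iff, ← hv', mul_smul, mul_smul, inv_smul_smul, ha]

theorem mem_normalizer_of_conj_mem {G : Type*} [Group G] [Finite G] {A : Subgroup G} {g : G}
    (h : ∀ a ∈ A, g * a * g⁻¹ ∈ A) : g ∈ normalizer (A : Set G) := by
  have hA : A.map (MulAut.conj g).toMonoidHom = A := by
    refine Subgroup.eq_of_le_of_card_ge ?_ (card_map_of_injective (MulAut.conj g).injective).ge
    rintro _ ⟨x, hx, rfl⟩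
    exact h x hx
  rw [Subgroup.mem_normalizer_iff]
  intro a
  refine ⟨h a, fun ha => ?_⟩
  have ha' : g * a * g⁻¹ ∈ A.map (MulAut.conj g).toMonoidHom := hA.symm ▸ ha
  obtain ⟨b, hb, hba⟩ := ha'
  have : b = a := (MulAut.conj g).injective hba
  exact this ▸ hb

/-- All T-conjugates of a complement A of V in E are V-conjugate, so T = N(A)V; `hfr` then makes A
normal. -/
theorem exists_normal_complement_of_isMulCommutative {p : ℕ} [Fact p.Prime] {T : Type*} [Group T]
    [Finite T] {V E : Subgroup T} (hV : V.Normal) (hE : E.Normal) (hVE : V ≤ E)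
    [IsMulCommutative V] (hp : IsPGroup p V) (hi : ¬ p ∣ V.relIndex E)
    (hfr : ∀ M : Subgroup T, M ⊔ V = ⊤ → M = ⊤) :
    ∃ A : Subgroup T, A.Normal ∧ A ⊓ V = ⊥ ∧ A ⊔ V = E := by
  set V' := V.subgroupOf E with hV'
  have hcard : Nat.card V' = Nat.card V := Nat.card_congr (subgroupOfEquivOfLe hVE).toEquiv
  have : IsMulCommutative V' := ⟨⟨fun a b => by
    have := (IsMulCommutative.is_comm (M := V)).comm ⟨(a : E), a.2⟩ ⟨(b : E), b.2⟩
    exact Subtype.ext (Subtype.ext (congrArg (fun x : V => (x : T)) this))⟩⟩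
  have hco : (Nat.card V').Coprime V'.index := by
    obtain ⟨n, hn⟩ := IsPGroup.iff_card.1 hp
    rw [hcard, hn]
    exact Nat.Coprime.pow_left n (((Fact.out : p.Prime).coprime_iff_not_dvd).2 hi)
  obtain ⟨A, hA⟩ := exists_right_complement'_of_coprime hco
  have hnorm : ∀ t : T, t ∈ normalizer (A.map E.subtype : Set T) ⊔ V := by
    intro t
    let φ : E ≃* E := MulAut.conjNormal t⁻¹
    have hA' : IsComplement' V' (A.map φ.toMonoidHom) := by
      have hc : Nat.card (A.map φ.toMonoidHom) = Nat.card A := card_map_of_injective φ.injective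
      refine isComplement'_of_coprime (by rw [hc, hA.card_mul_card]) ?_
      rwa [hc, ← hA.symm.index_eq_card]
    obtain ⟨v, hv, h⟩ := exists_conj_of_isComplement' hco hA hA'
    have h1 : t * v ∈ normalizer (A.map E.subtype : Set T) := by
      refine mem_normalizer_of_conj_mem ?_
      rintro _ ⟨a, ha, rfl⟩
      obtain ⟨b, hb, hba⟩ := h a ha
      refine ⟨b, hb, ?_⟩
      have h2 : t⁻¹ * (b : T) * t⁻¹⁻¹ = v * a * (v : T)⁻¹ := congrArg Subtype.val hba
      have h3 : (b : T) = t * (t⁻¹ * (b : T) * t⁻¹⁻¹) * t⁻¹ := by group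
      simp only [coe_subtype]
      rw [h3, h2]
      group
    have h4 : t = t * v * (v : T)⁻¹ := by group
    rw [h4]
    exact mul_mem (mem_sup_left h1) (mem_sup_right (V.inv_mem hv))
  have htop := hfr _ (eq_top_iff.2 fun t _ => hnorm t)
  refine ⟨A.map E.subtype, normalizer_eq_top_iff.1 htop, ?_, ?_⟩
  · rw [eq_bot_iff]
    rintro _ ⟨⟨a, ha, rfl⟩, hv⟩
    have : a ∈ V' ⊓ A := ⟨hv, ha⟩
    rw [hA.isCompl.inf_eq_bot, mem_bot] at this
    simp [this]
  · have h1 : V = V'.map E.subtype := by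
      rw [hV', subgroupOf_map_subtype, inf_eq_left.2 hVE]
    conv_lhs => rw [h1, ← Subgroup.map_sup, sup_comm, hA.sup_eq_top]
    simp [← MonoidHom.range_eq_map]

/-- Induction on |B|: modulo Z = Z(B) a normal complement exists, and its preimage is an extension
of the abelian group Z by a `p'`-group. -/
theorem exists_normal_complement {p : ℕ} [Fact p.Prime] (n : ℕ) {T : Type u} [Group T] [Finite T]
    {B E : Subgroup T} (hB : B.Normal) (hE : E.Normal) (hBE : B ≤ E) (hp : IsPGroup p B)
    (hi : ¬ p ∣ B.relIndex E) (hfr : ∀ M : Subgroup T, M ⊔ B = ⊤ → M = ⊤) (hn : Nat.card B = n) :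
    ∃ A : Subgroup T, A.Normal ∧ A ⊓ B = ⊥ ∧ A ⊔ B = E := by
  induction n using Nat.strong_induction_on generalizing T with
  | _ n ih =>
    rcases eq_or_ne B ⊥ with rfl | hne
    · exact ⟨E, hE, by simp, by simp⟩
    have hnt : Nontrivial B := nontrivial_iff_ne_bot B |>.2 hne
    set Z := (center B).map B.subtype with hZ
    have hZn : Z.Normal := inferInstance
    have hZB : Z ≤ B := map_subtype_le _
    have hZne : Z ≠ ⊥ := by
      rw [hZ, Ne, map_eq_bot_iff_of_injective _ B.subtype_injective]
      exact hp.bot_lt_center.ne'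
    have hZc : IsMulCommutative Z := ⟨⟨by
      rintro ⟨_, a, ha, rfl⟩ ⟨_, b, hb, rfl⟩
      exact Subtype.ext (congrArg (fun x : B => (x : T)) (mem_center_iff.1 hb a))⟩⟩
    let f := QuotientGroup.mk' Z
    have hf : Function.Surjective f := QuotientGroup.mk'_surjective Z
    have hker : f.ker = Z := QuotientGroup.ker_mk' Z
    have hcB : (B.map f).comap f = B := comap_map_eq_self (hker.le.trans hZB)
    have hcE : (E.map f).comap f = E := comap_map_eq_self (hker.le.trans (hZB.trans hBE))
    have hlt : Nat.card (B.map f) < n := by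
      have h1 : Z.relIndex B = Nat.card (B.map f) := by
        have := relIndex_ker (K := B) f
        rwa [hker] at this
      have h2 : Nat.card Z * Z.relIndex B = Nat.card B := by
        rw [← relIndex_bot_left, ← relIndex_bot_left,
          relIndex_mul_relIndex _ _ _ bot_le hZB]
      have h3 : 1 < Nat.card Z := Z.one_lt_card_iff_ne_bot.2 hZne
      have h4 : 0 < Nat.card (B.map f) := Nat.card_pos
      rw [h1] at h2
      rw [← hn, ← h2]
      exact lt_mul_of_one_lt_left h4 h3
    obtain ⟨A₁, hA₁, hA₁B, hA₁E⟩ := ih _ hlt (hB.map f hf) (hE.map f hf) (map_mono hBE)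
      (hp.map f) (fun h => hi (h.trans (relIndex_map_dvd hB hBE f))) (by
        intro M hM
        have h1 : M.comap f ⊔ B = ⊤ := by
          rw [← hcB, comap_sup_eq _ _ _ hf, hM, comap_top]
        have h2 := hfr _ h1
        rw [← map_comap_eq_self_of_surjective hf M, h2, map_top_of_surjective f hf]) rfl
    have h1 : A₁.comap f ⊓ B = Z := by
      rw [← hcB, ← comap_inf, hA₁B, MonoidHom.comap_bot, hker]
    have h2 : A₁.comap f ⊔ B = E := by
      rw [← hcB, comap_sup_eq _ _ _ hf, hA₁E, hcE]
    have h3 : Z.relIndex (A₁.comap f) = B.relIndex E := by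
      have := inf_relIndex_left (A₁.comap f) B
      rw [h1] at this
      rw [this, ← h2, sup_comm, relIndex_sup_left]
    have hA₂ : (A₁.comap f).Normal := inferInstance
    obtain ⟨A, hA, hAZ, hAE⟩ := exists_normal_complement_of_isMulCommutative (p := p) hZn hA₂
      (h1.ge.trans inf_le_left) (hp.to_le hZB) (by rwa [h3])
      (fun M hM => hfr M (eq_top_iff.2 (hM.ge.trans (sup_le_sup_left hZB M))))
    refine ⟨A, hA, ?_, ?_⟩
    · have h4 : A ⊓ B ≤ Z := by
        rw [← h1]
        exact inf_le_inf_right B (le_sup_left.trans hAE.le)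
      exact eq_bot_iff.2 ((le_inf inf_le_left h4).trans hAZ.le)
    · rw [← h2, ← hAE, sup_assoc, sup_eq_right.2 hZB]

end Complement

/-! ### Sylow subgroups and `p`-group actions on minimal normal subgroups. -/

section Auxiliary

variable {p : ℕ} {G : Type u} [Group G]

/-- The weak norm with respect to the class of `p`-supersolvable groups. -/
abbrev pWeakNorm (p : ℕ) {G : Type u} [Group G] (H : Subgroup G) : Subgroup G :=
  weakNorm (fun (X : Type u) [Group X] => IsPSupersolvable p X) H

theorem mem_pWeakNorm {H : Subgroup G} {g : G} :
    g ∈ pWeakNorm p H ↔ ∀ T ≤ H, g ∈ normalizer (pRes p T : Set G) := by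
  simp only [pWeakNorm, weakNorm, mem_iInf]
  rfl

theorem mem_of_pow_mem_of_coprime {D : Subgroup G} (hD : D.Normal) {t : G} {m n : ℕ}
    (hm : t ^ m ∈ D) (hn : t ^ n ∈ D) (h : m.Coprime n) : t ∈ D := by
  rw [← QuotientGroup.eq_one_iff, QuotientGroup.mk_pow] at hm hn
  rw [← QuotientGroup.eq_one_iff]
  simpa [h.gcd_eq_one] using (pow_gcd_eq_one (M := G ⧸ D)).2 ⟨hm, hn⟩

theorem pow_relIndex_mem {D F : Subgroup G} (hD : D.Normal) {t : G} (ht : t ∈ F) :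
    t ^ D.relIndex F ∈ D :=
  (D.subgroupOf F).pow_index_mem ⟨t, ht⟩

theorem mem_map_sylow_of_mem_normalizer {F : Subgroup G} (P : Sylow p F) {a : G} (haF : a ∈ F)
    (hn : a ∈ normalizer (P.map F.subtype : Set G)) {k : ℕ} (hk : a ^ p ^ k = 1) :
    a ∈ P.map F.subtype := by
  have hmem : ∀ x : F, x ∈ (P : Subgroup F) ↔ (x : G) ∈ P.map F.subtype := fun x =>
    (mem_map_iff_mem F.subtype_injective (K := (P : Subgroup F)) (x := x)).symm
  let b : F := ⟨a, haF⟩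
  have hb : IsPGroup p (zpowers b) := by
    refine IsPGroup.of_card_dvd_pow (n := k) ?_
    rw [Nat.card_zpowers]
    exact orderOf_dvd_of_pow_eq_one (Subtype.ext hk)
  have hbn : b ∈ normalizer (P : Set F) := by
    rw [Subgroup.mem_set_normalizer_iff]
    intro x
    have := Subgroup.mem_normalizer_iff.1 hn x
    exact (hmem x).trans (this.trans (hmem (b * x * b⁻¹)).symm)
  have h : b ∈ zpowers b ⊓ (P : Subgroup F) := by
    rw [← hb.inf_normalizer_sylow P]
    exact ⟨mem_zpowers b, hbn⟩
  exact (hmem b).1 h.2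

theorem eq_one_of_pow_eq_one_of_mem {L : Subgroup G} (hp : p.Prime) (hL : ¬ p ∣ Nat.card L) {z : G}
    (hz : z ∈ L) {k : ℕ} (h : z ^ p ^ k = 1) : z = 1 := by
  have h1 : z ^ Nat.card L = 1 := congrArg Subtype.val (pow_card_eq_one' (x := (⟨z, hz⟩ : L)))
  have h2 : (p ^ k).Coprime (Nat.card L) := Nat.Coprime.pow_left k (hp.coprime_iff_not_dvd.2 hL)
  simpa [h2.gcd_eq_one] using pow_gcd_eq_one.2 ⟨h, h1⟩

variable [Finite G]

theorem le_sylow_sup [Fact p.Prime] {D F : Subgroup G} {n : ℕ}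
    (h : D.relIndex F = p ^ n) (P : Sylow p F) : F ≤ P.map F.subtype ⊔ D := by
  rw [← relIndex_eq_one]
  have h1 : (P.map F.subtype ⊔ D).relIndex F ∣ p ^ n :=
    h ▸ relIndex_dvd_of_le_left _ le_sup_right
  have h2 : (P.map F.subtype ⊔ D).relIndex F ∣ P.index := by
    have : (P.map F.subtype).relIndex F = P.index := by
      rw [relIndex, subgroupOf, comap_map_eq_self_of_injective F.subtype_injective]
    exact this ▸ relIndex_dvd_of_le_left _ le_sup_left
  have h3 : (p ^ n).Coprime P.index :=
    Nat.Coprime.pow_left n ((Fact.out : p.Prime).coprime_iff_not_dvd.2 P.not_dvd_index)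
  exact Nat.eq_one_of_dvd_coprimes h3 h1 h2

theorem exists_fixed_of_isPGroup [Fact p.Prime] {P L : Subgroup G} (hP : IsPGroup p P)
    (hL : L.Normal) (hpL : p ∣ Nat.card L) : ∃ x ∈ L, x ≠ 1 ∧ ∀ g ∈ P, g * x = x * g := by
  let φ : P →* MulAut L := (MulAut.conjNormal (H := L)).comp P.subtype
  let _ : MulAction P L := MulAction.compHom L φ
  have hone : (1 : L) ∈ MulAction.fixedPoints P L := fun g => map_one (φ g)
  obtain ⟨x, hx, hne⟩ := hP.exists_fixed_point_of_prime_dvd_card_of_fixed_point L hpL hone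
  refine ⟨x, x.2, fun h => hne (Subtype.ext h.symm), fun g hg => ?_⟩
  have h : g * (x : G) * g⁻¹ = x := congrArg Subtype.val (hx ⟨g, hg⟩)
  exact mul_inv_eq_iff_eq_mul.1 h

/-- P fixes some x ≠ 1 in L, hence so does K; thus C_L(K) is a nontrivial normal subgroup of G
inside L, that is, L itself. -/
theorem le_centralizer_of_le_sup [Fact p.Prime] {L K P : Subgroup G} (hL : IsChiefFactor ⊥ L)
    (hpL : p ∣ Nat.card L) (hK : K.Normal) (hP : IsPGroup p P)
    (hKP : K ≤ P ⊔ centralizer (L : Set G)) : K ≤ centralizer (L : Set G) := by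
  have hLn := hL.normal_top
  obtain ⟨x, hx, hne, hfix⟩ := exists_fixed_of_isPGroup hP hLn hpL
  have hxK : x ∈ centralizer (K : Set G) := by
    have h : P ⊔ centralizer (L : Set G) ≤ centralizer ({x} : Set G) := by
      refine sup_le (fun g hg => ?_) (centralizer_le (Set.singleton_subset_iff.2 hx))
      exact mem_centralizer_singleton_iff.2 (hfix g hg)
    intro g hg
    exact mem_centralizer_singleton_iff.1 (h (hKP hg))
  rcases hL.eq_or_eq (L ⊓ centralizer (K : Set G)) inferInstance bot_le inf_le_left with h | h
  · have : x ∈ (⊥ : Subgroup G) := h ▸ ⟨hx, hxK⟩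
    exact absurd this hne
  · rw [inf_eq_left] at h
    exact le_centralizer_iff.1 h

end Auxiliary

/-! ### The two cases for L, and the theorem. -/

section Main

variable {p : ℕ} {G : Type u} [Group G] [Finite G]

theorem pRes_le_centralizer_of_not_dvd (hp : p.Prime) (hG : IsPSolvable p G) {H L : Subgroup G}
    (hH : H.Normal) (hL : L.Normal) (hpL : ¬ p ∣ Nat.card L)
    (hLN : ∀ T ≤ H, ∀ l ∈ L, ∀ x ∈ pRes p T, l * x * l⁻¹ ∈ pRes p T) :
    pRes p H ≤ centralizer (L : Set G) := by
  have : Fact p.Prime := ⟨hp⟩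
  set C := centralizer (L : Set G) ⊓ H with hC
  have hCn : C.Normal := inferInstance
  obtain ⟨D, ⟨hD, hCD, hDH, hi⟩, hmax⟩ :=
    (Set.toFinite {D : Subgroup G | D.Normal ∧ C ≤ D ∧ D ≤ H ∧ ¬ p ∣ C.relIndex D}).exists_maximal
      ⟨C, hCn, le_rfl, inf_le_right, by simpa using hp.ne_one⟩
  suffices h : pRes p H ≤ D from
    (pRes_le_of_not_dvd hp hCn hD hCD hDH hi h).trans inf_le_left
  by_contra hnot
  have hRn := pRes_normal hp hH
  obtain ⟨F, hF, hFH⟩ := exists_isChiefFactor hD (inferInstance : (pRes p H ⊔ D).Normal)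
    (right_lt_sup.2 hnot)
  have hFn := hF.normal_top
  have hFH' : F ≤ H := hFH.trans (sup_le (pRes_le H) hDH)
  rcases hG.chief D F hF with ⟨n, hn⟩ | hn
  swap
  · refine hF.lt.not_ge (hmax ⟨hFn, hCD.trans hF.lt.le, hFH', ?_⟩ hF.lt.le)
    rw [← relIndex_mul_relIndex C D F hCD hF.lt.le]
    exact fun h => (hp.dvd_mul.1 h).elim hi hn
  obtain ⟨P₀⟩ : Nonempty (Sylow p F) := inferInstance
  set P := P₀.map F.subtype with hP
  have hPp : IsPGroup p P := P₀.isPGroup'.map F.subtype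
  have hPF : P ≤ F := map_subtype_le _
  set T := normalizer (P : Set G) ⊓ H with hT
  have hTH : T ≤ H := inf_le_right
  have hPT : P ≤ T := le_inf le_normalizer (hPF.trans hFH')
  have hTD : T ⊔ D = H ⊔ D := by
    rw [sup_eq_left.2 hDH]
    refine le_antisymm (sup_le hTH hDH) ?_
    have hF1 : F ≤ T ⊔ D := (le_sylow_sup hn P₀).trans (sup_le_sup_right hPT D)
    intro x hx
    have hx' : x ∈ normalizer (P : Set G) ⊔ F := by
      rw [hP, P₀.normalizer_sup_eq_top]
      trivial
    obtain ⟨y, hy, f, hf, rfl⟩ := mem_sup_of_normal_right.1 hx'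
    have hyH : y ∈ H := by simpa using H.mul_mem hx (H.inv_mem (hFH' hf))
    exact mul_mem (mem_sup_left ⟨hy, hyH⟩) (hF1 hf)
  have hres := pRes_sup_eq hp hD hTD
  refine hF.lt.not_ge fun x hx => ?_
  have hx' := hFH hx
  rw [← hres] at hx'
  obtain ⟨t, ht, d, hd, rfl⟩ := mem_sup_of_normal_right.1 hx'
  refine D.mul_mem ?_ hd
  have htF : t ∈ F := by simpa using F.mul_mem hx (F.inv_mem (hF.lt.le hd))
  have htT : t ∈ T := pRes_le T ht
  -- With m the `p'`-part of the order of t, t ^ m is a `p`-element.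
  obtain ⟨k, m, hm, ho⟩ :=
    Nat.exists_eq_pow_mul_and_not_dvd (orderOf_pos t).ne' p hp.ne_one
  have hak : (t ^ m) ^ p ^ k = 1 := by
    rw [← pow_mul, mul_comm, ← ho, pow_orderOf_eq_one]
  have haR : t ^ m ∈ pRes p T := pow_mem ht m
  have haP : t ^ m ∈ P :=
    mem_map_sylow_of_mem_normalizer P₀ (pow_mem htF m) (pow_mem htT.1 m) hak
  have haC : t ^ m ∈ D := by
    refine hCD ⟨?_, hTH (pRes_le T haR)⟩
    generalize t ^ m = a at hak haR haP
    intro l hl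
    set z := l * a * l⁻¹ * a⁻¹ with hz
    have hzR : z ∈ pRes p T := mul_mem (hLN T hTH l hl a haR) (inv_mem haR)
    have hzL : z ∈ L := by
      have : z = l * (a * l⁻¹ * a⁻¹) := by rw [hz]; group
      rw [this]
      exact mul_mem hl (hL.conj_mem _ (inv_mem hl) a)
    -- z lies in T, so it normalizes P, and [z, a] ∈ P ∩ L = 1.
    have hza : z * a * z⁻¹ * a⁻¹ = 1 := by
      have h1 : z * a * z⁻¹ * a⁻¹ ∈ P :=
        mul_mem ((Subgroup.mem_normalizer_iff.1 (pRes_le T hzR).1 a).1 haP) (inv_mem haP)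
      have h2 : z * a * z⁻¹ * a⁻¹ ∈ L := by
        have : z * a * z⁻¹ * a⁻¹ = z * (a * z⁻¹ * a⁻¹) := by group
        rw [this]
        exact mul_mem hzL (hL.conj_mem _ (inv_mem hzL) a)
      obtain ⟨j, hj⟩ := hPp ⟨_, h1⟩
      exact eq_one_of_pow_eq_one_of_mem hp hpL h2 (congrArg Subtype.val hj)
    have hcomm : Commute z a := mul_inv_eq_iff_eq_mul.1 (mul_inv_eq_one.1 hza)
    have hconj : z * a = l * a * l⁻¹ := by rw [hz]; group
    -- z commutes with a, and za is a conjugate of a, so z is a `p`-element of the `p'`-group L.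
    have hzk : z ^ p ^ k = 1 := by
      have h1 : (z * a) ^ p ^ k = 1 := by rw [hconj, conj_pow, hak]; group
      rwa [hcomm.mul_pow, hak, mul_one] at h1
    have hz1 := eq_one_of_pow_eq_one_of_mem hp hpL hzL hzk
    rw [hz1, one_mul] at hconj
    exact (mul_inv_eq_iff_eq_mul.1 hconj.symm)
  refine mem_of_pow_mem_of_coprime hD haC (pow_relIndex_mem hD htF) ?_
  rw [hn]
  exact (Nat.Coprime.pow_left n (hp.coprime_iff_not_dvd.2 hm)).symm

/-- Minimality of T puts C ∩ T in the Frattini subgroup of T. -/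
theorem exists_minimal_supplement {H C : Subgroup G} (hCH : C ≤ H) : ∃ T ≤ H, T ⊔ C = H ∧
    ∀ M : Subgroup T, M ⊔ C.subgroupOf T = ⊤ → M = ⊤ := by
  obtain ⟨T, ⟨hTH, hTC⟩, hmin⟩ :=
    (Set.toFinite {T : Subgroup G | T ≤ H ∧ T ⊔ C = H}).exists_minimal ⟨H, le_rfl, by simpa⟩
  refine ⟨T, hTH, hTC, fun M hM => ?_⟩
  have hMT : M.map T.subtype ≤ T := map_subtype_le M
  have h1 : T ≤ M.map T.subtype ⊔ C := by
    have : T = (M ⊔ C.subgroupOf T).map T.subtype := by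
      rw [hM, ← MonoidHom.range_eq_map, range_subtype]
    conv_lhs => rw [this, Subgroup.map_sup, subgroupOf_map_subtype]
    exact sup_le_sup_left inf_le_left _
  have h2 : M.map T.subtype ⊔ C = H :=
    le_antisymm (sup_le (hMT.trans hTH) hCH) (hTC ▸ sup_le h1 le_sup_right)
  have h3 : T ≤ M.map T.subtype := hmin ⟨hMT.trans hTH, h2⟩ hMT
  refine eq_top_iff.2 fun x _ => ?_
  obtain ⟨y, hy, hyx⟩ := h3 x.2
  exact (Subtype.ext hyx : y = x) ▸ hy

theorem exists_normal_sylow_of_minimal_supplement [Fact p.Prime] {C : Subgroup G} (hC : C.Normal)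
    (hfr : ∀ M : Subgroup G, M ⊔ C = ⊤ → M = ⊤) :
    ∃ B : Subgroup G, B.Normal ∧ B ≤ C ∧ IsPGroup p B ∧ ¬ p ∣ B.relIndex C ∧
      ∀ K : Subgroup G, K.Normal → K ≤ C → IsPGroup p K → K ≤ B := by
  obtain ⟨S⟩ : Nonempty (Sylow p C) := inferInstance
  refine ⟨S.map C.subtype, normalizer_eq_top_iff.1 (hfr _ S.normalizer_sup_eq_top),
    map_subtype_le _, S.isPGroup'.map _, ?_, fun K hK hKC hKp => ?_⟩
  · rw [relIndex, subgroupOf, comap_map_eq_self_of_injective C.subtype_injective]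
    exact S.not_dvd_index
  · have h : IsPGroup p (K.subgroupOf C) := hKp.comap_subtype
    intro x hx
    exact ⟨⟨x, hKC hx⟩, h.le_sylow_of_normal S hx, rfl⟩

theorem pRes_le_centralizer_of_isPGroup (hp : p.Prime) (hG : IsPSolvable p G) {H L : Subgroup G}
    (hH : H.Normal) (hL : IsChiefFactor ⊥ L) (hpL : IsPGroup p L)
    (hLN : ∀ T ≤ H, ∀ l ∈ L, ∀ x ∈ pRes p T, l * x * l⁻¹ ∈ pRes p T) :
    pRes p H ≤ centralizer (L : Set G) := by
  have : Fact p.Prime := ⟨hp⟩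
  have hLn := hL.normal_top
  have hdvd : p ∣ Nat.card L :=
    hpL.card_eq_or_dvd.resolve_left fun h => hL.lt.ne (card_eq_one.1 h).symm
  have hLL : L ≤ centralizer (L : Set G) :=
    le_centralizer_of_le_sup hL hdvd hLn hpL le_sup_left
  set C := centralizer (L : Set G) ⊓ H with hC
  have hCn : C.Normal := inferInstance
  have hCH : C ≤ H := inf_le_right
  rcases hCH.eq_or_lt with h | hlt
  · exact (pRes_le H).trans (h.ge.trans inf_le_left)
  obtain ⟨E, hE, hEH⟩ := exists_isChiefFactor hCn hH hlt
  have hEn := hE.normal_top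
  have hEL : ¬ E ≤ centralizer (L : Set G) := fun h => hE.lt.not_ge (le_inf h hEH)
  -- Were E/C a `p`-group, E would be a Sylow subgroup times C and so would centralize L.
  have hi : ¬ p ∣ C.relIndex E := by
    refine (hG.chief C E hE).resolve_left ?_
    rintro ⟨n, hn⟩
    obtain ⟨P⟩ : Nonempty (Sylow p E) := inferInstance
    exact hEL (le_centralizer_of_le_sup hL hdvd hEn (P.isPGroup'.map E.subtype)
      ((le_sylow_sup hn P).trans (sup_le_sup_left inf_le_left _)))
  obtain ⟨T, hTH, hTC, hfr⟩ := exists_minimal_supplement hCH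
  obtain ⟨B, hB, hBC, hBp, hBi, hBmax⟩ :=
    exists_normal_sylow_of_minimal_supplement (p := p) (C := C.subgroupOf T) inferInstance hfr
  have hCE : C.subgroupOf T ≤ E.subgroupOf T := comap_mono hE.lt.le
  obtain ⟨A, hA, hAB, hAE⟩ := exists_normal_complement (p := p) _ (E := E.subgroupOf T) hB
    inferInstance (hBC.trans hCE) hBp (by
      rw [← relIndex_mul_relIndex B _ _ hBC hCE]
      exact fun h => (hp.dvd_mul.1 h).elim hBi fun h =>
        hi (h.trans (relIndex_comap_dvd hCn T.subtype)))
    (fun M hM => hfr M (eq_top_iff.2 (hM.ge.trans (sup_le_sup_left hBC M)))) rfl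
  have hLB : L.subgroupOf T ≤ B := by
    refine hBmax _ inferInstance (fun x hx => ⟨hLL hx, hTH x.2⟩) ?_
    exact hpL.comap_subtype
  -- E = (E ∩ T)C with E ∩ T = A × B. A centralizes L ∩ T ≤ B, while B and C centralize L, so L ∩ T
  -- ≤ C_L(E) = 1.
  have hLT : ∀ x ∈ L, x ∈ T → x = 1 := by
    intro x hxL hxT
    have hxE : x ∈ centralizer (E : Set G) := by
      intro e he
      have he' : e ∈ T ⊔ C := hTC.ge (hEH he)
      obtain ⟨t, ht, c, hc, rfl⟩ := mem_sup_of_normal_right.1 he'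
      have htE : (⟨t, ht⟩ : T) ∈ A ⊔ B := by
        rw [hAE]
        have : t ∈ E := by simpa using E.mul_mem he (E.inv_mem (hE.lt.le hc))
        exact this
      obtain ⟨a, ha, b, hb, hab⟩ := mem_sup_of_normal_right.1 htE
      have hab' : (a : G) * b = t := congrArg Subtype.val hab
      have hxa : Commute (a : G) x := congrArg Subtype.val
        (commute_of_normal_of_disjoint A B hA hB (disjoint_iff.2 hAB) a ⟨x, hxT⟩ ha
          (hLB hxL)).eq
      have hxb : Commute (b : G) x := ((hBC hb).1 x hxL).symm
      have hxc : Commute c x := (hc.1 x hxL).symm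
      rw [← hab']
      exact ((hxa.mul_left hxb).mul_left hxc).eq
    rcases hL.eq_or_eq (L ⊓ centralizer (E : Set G)) inferInstance bot_le inf_le_left with h | h
    · have : x ∈ (⊥ : Subgroup G) := h ▸ ⟨hxL, hxE⟩
      exact this
    · exact absurd (le_centralizer_iff.1 (inf_eq_left.1 h)) hEL
  have hTL : pRes p T ≤ C := by
    intro t ht
    refine ⟨fun l hl => ?_, hTH (pRes_le T ht)⟩
    have h1 : l * t * l⁻¹ * t⁻¹ ∈ T := pRes_le T (mul_mem (hLN T hTH l hl t ht) (inv_mem ht))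
    have h2 : l * t * l⁻¹ * t⁻¹ ∈ L := by
      have : l * t * l⁻¹ * t⁻¹ = l * (t * l⁻¹ * t⁻¹) := by group
      rw [this]
      exact mul_mem hl (hLn.conj_mem _ (inv_mem hl) t)
    exact mul_inv_eq_iff_eq_mul.1 (mul_inv_eq_one.1 (hLT _ h2 h1))
  have h := pRes_sup_eq hp hCn (T := T) (H := H) (by rw [hTC, sup_eq_left.2 hCH])
  rw [sup_eq_right.2 hTL] at h
  exact (le_sup_left.trans h.ge).trans inf_le_left

theorem pWeakNorm_normal (hp : p.Prime) {H : Subgroup G} (hH : H.Normal) :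
    (pWeakNorm p H).Normal := by
  refine ⟨fun n hn g => mem_pWeakNorm.2 fun T hT => mem_normalizer_of_conj_mem fun a ha => ?_⟩
  set T' := T.map (MulAut.conj g⁻¹).toMonoidHom with hT'
  have hT'H : T' ≤ H := by
    rintro _ ⟨x, hx, rfl⟩
    exact hH.conj_mem x (hT hx) g⁻¹
  have hback : T'.map (MulAut.conj g).toMonoidHom = T := by
    rw [hT', map_map]
    convert T.map_id
    ext x
    simp [mul_assoc]
  have h1 : g⁻¹ * a * g⁻¹⁻¹ ∈ pRes p T' := by
    rw [hT', ← pRes_map hp]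
    exact ⟨a, ha, rfl⟩
  have h2 := (Subgroup.mem_normalizer_iff.1 (mem_pWeakNorm.1 hn T' hT'H) _).1 h1
  rw [← hback, ← pRes_map hp]
  refine ⟨_, h2, ?_⟩
  simp [mul_assoc]

theorem centralizer_le_pWeakNorm (hp : p.Prime) (H : Subgroup G) :
    centralizer (pRes p H : Set G) ≤ pWeakNorm p H := by
  refine fun g hg => mem_pWeakNorm.2 fun T hT => mem_normalizer_of_conj_mem fun a ha => ?_
  rwa [← hg a (pRes_mono hp hT ha), mul_inv_cancel_right]

theorem pWeakNorm_eq_bot_iff (hp : p.Prime) (hG : IsPSolvable p G) {H : Subgroup G}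
    (hH : H.Normal) : pWeakNorm p H = ⊥ ↔ centralizer (pRes p H : Set G) = ⊥ := by
  refine ⟨fun h => eq_bot_iff.2 (h ▸ centralizer_le_pWeakNorm hp H), fun h => ?_⟩
  by_contra hne
  obtain ⟨L, hL, hLN⟩ := exists_isChiefFactor (inferInstance : (⊥ : Subgroup G).Normal)
    (pWeakNorm_normal hp hH) (bot_lt_iff_ne_bot.2 hne)
  have hconj : ∀ T ≤ H, ∀ l ∈ L, ∀ x ∈ pRes p T, l * x * l⁻¹ ∈ pRes p T :=
    fun T hT l hl x hx =>
      (Subgroup.mem_normalizer_iff.1 (mem_pWeakNorm.1 (hLN hl) T hT) x).1 hx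
  have hcent : pRes p H ≤ Subgroup.centralizer (L : Set G) := by
    have hc := hG.chief ⊥ L hL
    rw [Subgroup.relIndex_bot_left] at hc
    rcases hc with ⟨n, hn⟩ | hn
    · exact pRes_le_centralizer_of_isPGroup hp hG hH hL (IsPGroup.of_card hn) hconj
    · exact pRes_le_centralizer_of_not_dvd hp hG hH hL.normal_top hn hconj
  exact hL.lt.not_ge (h ▸ Subgroup.le_centralizer_iff.1 hcent)

end Main

end WeakNorm

theorem theorem3p4 (p : ℕ) (hp : p.Prime) {G : Type u} [Group G] [Finite G]
    (hG : WeakNorm.IsPSolvable p G) (H : Subgroup G) (hH : H.Normal) :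
    WeakNorm.weakNorm (fun (X : Type u) [Group X] => WeakNorm.IsPSupersolvable p X) H = ⊥ ↔
      Subgroup.centralizer
        (WeakNorm.subgroupResidual
          (fun (X : Type u) [Group X] => WeakNorm.IsPSupersolvable p X) H : Set G) = ⊥ :=
  WeakNorm.pWeakNorm_eq_bot_iff hp hG hH
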